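/- Let $N\ge 2$ and let $y_1,\dots,y_N$ be i.i.d. real random variables with law $\mathcal N(a,\sigma^2)$, where $a\in\mathbb R$ and $\sigma^2>0$ are unknown. Consider testing $\mathcal H_0: a=0$ against $\mathcal H_1: a\neq 0$. For a sample $y=(y_1,\dots,y_N)$ with mean $\bar y=\frac1N\sum_k y_k$ put $$L(y)=\frac{(N-1)\left(\sum_{k=1}^N y_k\right)^2}{N\sum_{k=1}^N (y_k-\bar y)^2},\qquad p(y;\mu,v)=\prod_{k=1}^N\frac{1}{\sqrt{2\pi v}}\,e^{-(y_k-\mu)^2/(2v)},\qquad \Lambda(y)=\frac{\sup_{\mu\neq 0,\ v>0}p(y;\mu,v)}{\sup_{v>0}p(y;0,v)}.$$ 1. ($L$ is the generalized likelihood ratio test statistic.) For every $y\in\mathbb R^N$ whose coordinates are not all equal, both suprema are finite, the denominator of $\Lambda(y)$ is positive, and $$L(y)=(N-1)\left(\Lambda(y)^{2/N}-1\right).$$ Hence, for every threshold $b\ge 0$, $L(y)>b$ if and only if $\Lambda(y)>\left(1+\frac{b}{N-1}\right)^{N/2}$. The random sample almost surely has coordinates that are not all equal. 2. (Distribution of $L$.)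 Under $\mathcal H_0$, $L(y_1,\dots,y_N)$ has the central Fisher–Snedecor distribution $F(1,N-1)$. Under $\mathcal H_1$, it has the noncentral Fisher–Snedecor distribution $F'\!\left(1,N-1,\frac{N a^2}{\sigma^2}\right)$. Here $\chi^2_d$ is the law of $\sum_{i=1}^d Z_i^2$ with $Z_i$ independent $\mathcal N(0,1)$; $\chi'^2_d(\lambda)$ is the law of $\sum_{i=1}^d X_i^2$ with $X_i$ independent $\mathcal N(\mu_i,1)$ and $\sum_i\mu_i^2=\lambda$; $F(d_1,d_2)$ and $F'(d_1,d_2,\lambda)$ are the laws of $\frac{X_1/d_1}{X_2/d_2}$ with $X_1,X_2$ independent, $X_2\sim\chi^2_{d_2}$, and $X_1\sim\chi^2_{d_1}$, respectively $X_1\sim\chi'^2_{d_1}(\lambda)$. -/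

import Mathlib

open MeasureTheory ProbabilityTheory
open scoped NNReal

namespace GLRT

noncomputable section

/-- The statistic
`(n - 1) (∑ y_k)² / (n ∑ (y_k - ȳ)²)` with `ȳ = (1 / n) ∑ y_k`. -/
def statistic {n : ℕ} (y : Fin n → ℝ) : ℝ :=
  (((n : ℝ) - 1) * (∑ k, y k) ^ 2) /
    ((n : ℝ) * ∑ k, (y k - (1 / (n : ℝ)) * ∑ j, y j) ^ 2)

/-- The likelihood of the parameter `θ = (mean, variance)` at the sample `y`: the joint density
at `y` of `n` independent Gaussian variables with this mean and variance. -/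
def likelihood {n : ℕ} (y : Fin n → ℝ) (θ : ℝ × ℝ≥0) : ℝ :=
  ∏ k, gaussianPDFReal θ.1 θ.2 (y k)

/-- Null hypothesis: the mean is zero; the variance is an unknown positive number. -/
def nullHypothesis : Set (ℝ × ℝ≥0) := {θ | θ.1 = 0 ∧ 0 < θ.2}

/-- Alternative: the mean is an unknown nonzero number; the variance is an unknown positive
number. -/
def altHypothesis : Set (ℝ × ℝ≥0) := {θ | θ.1 ≠ 0 ∧ 0 < θ.2}

/-- Supremum of the likelihood over a set of parameters. -/
def supLikelihood {n : ℕ} (Θ : Set (ℝ × ℝ≥0)) (y : Fin n → ℝ) : ℝ :=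
  sSup (likelihood y '' Θ)

/-- The generalized likelihood ratio: unknown parameters are maximized out under each hypothesis. -/
def likelihoodRatio {n : ℕ} (y : Fin n → ℝ) : ℝ :=
  supLikelihood altHypothesis y / supLikelihood nullHypothesis y

/-- Central chi-square distribution with `d` degrees of freedom: the law of `∑ Z_i²` for
independent standard Gaussian variables `Z_1, …, Z_d`. -/
def chiSq (d : ℕ) : Measure ℝ :=
  (Measure.pi fun _ : Fin d => gaussianReal 0 1).map fun z => ∑ i, z i ^ 2

/-- Noncentral chi-square distribution with `d` degrees of freedom and noncentrality `lam ≥ 0`: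
the law of `∑ X_i²` for independent `X_i ~ N(μ_i, 1)` with `∑ μ_i² = lam`. By rotation invariance
this law depends on the means only through `lam`; here the mean vector is `(√lam, 0, …, 0)`. -/
def noncentralChiSq (d : ℕ) (lam : ℝ) : Measure ℝ :=
  (Measure.pi fun i : Fin d => gaussianReal (if (i : ℕ) = 0 then √lam else 0) 1).map
    fun x => ∑ i, x i ^ 2

/-- Central Fisher–Snedecor distribution `F(d₁, d₂)`: the law of `(X₁ / d₁) / (X₂ / d₂)` for
independent central chi-square variables `X₁`, `X₂` with `d₁`, `d₂` degrees of freedom. -/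
def fisher (d₁ d₂ : ℕ) : Measure ℝ :=
  ((chiSq d₁).prod (chiSq d₂)).map fun x => (x.1 / (d₁ : ℝ)) / (x.2 / (d₂ : ℝ))

/-- Noncentral Fisher–Snedecor distribution `F'(d₁, d₂, lam)`: the law of
`(X₁ / d₁) / (X₂ / d₂)` for independent `X₁`, `X₂`, where `X₁` is noncentral chi-square with `d₁`
degrees of freedom and noncentrality `lam`, and `X₂` is central chi-square with `d₂` degrees of
freedom. -/
def noncentralFisher (d₁ d₂ : ℕ) (lam : ℝ) : Measure ℝ :=
  ((noncentralChiSq d₁ lam).prod (chiSq d₂)).map fun x => (x.1 / (d₁ : ℝ)) / (x.2 / (d₂ : ℝ))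

end

end GLRT

namespace GLRT

/-! With residual sum of squares `S`, the Gaussian likelihood peaks at variance `S / n`, with value
proportional to `S ^ (-n / 2)`. The null residual is `∑ y_k²`; under the alternative the least
residual is the one about the sample mean. So `Λ ^ (2 / n)` is their quotient, which Pythagoras
(`sum_sq_eq`) turns into `1 + L / (n - 1)`.

For the law, `L` is scale invariant, so the variance may be taken to be 1. A rotation sending the
diagonal direction to the first axis (`exists_isometry_statistic`) keeps the coordinates independent
with unit variance. The squared first coordinate becomes `(∑ y_k)² / n`, the others carry the
residual, and the mean vector moves onto the first axis. This treats every `a` at once; the null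
case is noncentrality 0. -/

/-! ### Maximizing the Gaussian likelihood -/

theorem sum_sub_sq {n : ℕ} (hn : n ≠ 0) (y : Fin n → ℝ) (μ : ℝ) :
    ∑ k, (y k - μ) ^ 2 = ∑ k, (y k - (1 / (n : ℝ)) * ∑ j, y j) ^ 2 +
      n * (μ - (1 / (n : ℝ)) * ∑ j, y j) ^ 2 := by
  have hn' : (n : ℝ) ≠ 0 := Nat.cast_ne_zero.mpr hn
  have key : ∀ c : ℝ, ∑ k, (y k - c) ^ 2 = ∑ k, y k ^ 2 - 2 * c * ∑ k, y k + n * c ^ 2 := by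
    intro c
    simp only [sub_sq, Finset.sum_add_distrib, Finset.sum_sub_distrib, Finset.sum_const,
      Finset.card_univ, Fintype.card_fin, nsmul_eq_mul, Finset.mul_sum]
    congr 2
    exact Finset.sum_congr rfl fun k _ => by ring
  rw [key, key]
  field_simp
  ring

theorem sum_sq_eq {n : ℕ} (hn : n ≠ 0) (y : Fin n → ℝ) :
    ∑ k, y k ^ 2 = ∑ k, (y k - (1 / (n : ℝ)) * ∑ j, y j) ^ 2 + (∑ k, y k) ^ 2 / n := by
  have hn' : (n : ℝ) ≠ 0 := Nat.cast_ne_zero.mpr hn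
  have h := sum_sub_sq hn y 0
  simp only [sub_zero] at h
  rw [h]
  congr 1
  field_simp
  ring

theorem sum_sub_sq_pos {n : ℕ} {y : Fin n → ℝ} (hy : ∃ i j, y i ≠ y j) (μ : ℝ) :
    0 < ∑ k, (y k - μ) ^ 2 := by
  obtain ⟨i, j, hij⟩ := hy
  refine (Finset.sum_nonneg fun k _ => sq_nonneg _).lt_of_ne' fun h => hij ?_
  rw [Finset.sum_eq_zero_iff_of_nonneg fun k _ => sq_nonneg _] at h
  have hi := h i (Finset.mem_univ i)
  have hj := h j (Finset.mem_univ j)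
  rw [sq_eq_zero_iff] at hi hj
  linarith

theorem likelihood_eq {n : ℕ} (y : Fin n → ℝ) (θ : ℝ × ℝ≥0) :
    likelihood y θ = (√(2 * Real.pi * θ.2))⁻¹ ^ n *
      Real.exp (-(∑ k, (y k - θ.1) ^ 2) / (2 * θ.2)) := by
  simp only [likelihood, gaussianPDFReal, Finset.prod_mul_distrib, Finset.prod_const,
    Finset.card_univ, Fintype.card_fin, ← Real.exp_sum, ← Finset.sum_div, Finset.sum_neg_distrib]

/-- The maximum over the variance of the Gaussian likelihood with residual sum of squares `S`. -/
noncomputable def maxLikelihood (n : ℕ) (S : ℝ) : ℝ :=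
  (√(2 * Real.pi * (S / n)))⁻¹ ^ n * Real.exp (-(n / 2 : ℝ))

theorem maxLikelihood_pos {n : ℕ} (hn : n ≠ 0) {S : ℝ} (hS : 0 < S) : 0 < maxLikelihood n S := by
  have hn' : (0 : ℝ) < n := Nat.cast_pos.mpr (Nat.pos_of_ne_zero hn)
  have := Real.pi_pos
  unfold maxLikelihood
  positivity

/-- With `t = S / (n v)`, this is the `n`-th power of `√t * exp (-t / 2) ≤ exp (-1 / 2)`, that is,
of `log t ≤ t - 1`. -/
theorem inv_sqrt_pow_mul_exp_le {n : ℕ} (hn : n ≠ 0) {S T v : ℝ} (hS : 0 < S) (hST : S ≤ T)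
    (hv : 0 < v) :
    (√(2 * Real.pi * v))⁻¹ ^ n * Real.exp (-T / (2 * v)) ≤ maxLikelihood n S := by
  have hn' : (0 : ℝ) < n := Nat.cast_pos.mpr (Nat.pos_of_ne_zero hn)
  have hpi := Real.pi_pos
  set t := S / n / v with ht
  have htpos : 0 < t := by positivity
  have hsqrt : √(2 * Real.pi * (S / n)) = √(2 * Real.pi * v) * √t := by
    rw [← Real.sqrt_mul (by positivity)]
    congr 1
    rw [ht]
    field_simp
  have hexp : Real.exp (-T / (2 * v)) ≤ Real.exp (-(t / 2)) ^ n := by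
    rw [← Real.exp_nat_mul]
    refine Real.exp_le_exp.mpr ?_
    have : (n : ℝ) * -(t / 2) = -S / (2 * v) := by
      rw [ht]
      field_simp
    rw [this]
    gcongr
  have hroot : √t * Real.exp (-(t / 2)) ≤ Real.exp (-(1 / 2)) := by
    rw [Real.sqrt_eq_rpow, Real.rpow_def_of_pos htpos, ← Real.exp_add, Real.exp_le_exp]
    linarith [Real.log_le_sub_one_of_pos htpos]
  have hexp' : Real.exp (-(n / 2 : ℝ)) = Real.exp (-(1 / 2)) ^ n := by
    rw [← Real.exp_nat_mul]
    congr 1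
    ring
  rw [maxLikelihood, hsqrt, hexp', mul_inv, mul_pow, mul_assoc (_ ^ n)]
  refine mul_le_mul_of_nonneg_left (hexp.trans ?_) (by positivity)
  rw [← mul_pow]
  refine pow_le_pow_left₀ (Real.exp_nonneg _) ?_ n
  rwa [inv_mul_eq_div, le_div_iff₀' (Real.sqrt_pos.mpr htpos)]

theorem likelihood_le {n : ℕ} (hn : n ≠ 0) {y : Fin n → ℝ} {θ : ℝ × ℝ≥0} (hθ : 0 < θ.2) {S : ℝ}
    (hS : 0 < S) (hST : S ≤ ∑ k, (y k - θ.1) ^ 2) : likelihood y θ ≤ maxLikelihood n S := by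
  rw [likelihood_eq]
  exact inv_sqrt_pow_mul_exp_le hn hS hST hθ

theorem likelihood_mk_div {n : ℕ} (hn : n ≠ 0) {y : Fin n → ℝ} {μ : ℝ}
    (hS : 0 < ∑ k, (y k - μ) ^ 2) :
    likelihood y (μ, ((∑ k, (y k - μ) ^ 2) / n).toNNReal) =
      maxLikelihood n (∑ k, (y k - μ) ^ 2) := by
  have hn' : (0 : ℝ) < n := Nat.cast_pos.mpr (Nat.pos_of_ne_zero hn)
  rw [likelihood_eq, maxLikelihood]
  simp only [Real.coe_toNNReal _ (div_pos hS hn').le]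
  congr 2
  field_simp

theorem isLUB_likelihood_null {n : ℕ} (hn : n ≠ 0) {y : Fin n → ℝ} (hy : ∃ i j, y i ≠ y j) :
    IsLUB (likelihood y '' nullHypothesis) (maxLikelihood n (∑ k, y k ^ 2)) := by
  have hn' : (0 : ℝ) < n := Nat.cast_pos.mpr (Nat.pos_of_ne_zero hn)
  have hS := sum_sub_sq_pos hy 0
  have hmax := likelihood_mk_div hn hS
  simp only [sub_zero] at hS hmax
  refine IsGreatest.isLUB ⟨⟨_, ⟨rfl, ?_⟩, hmax⟩, ?_⟩
  · exact Real.toNNReal_pos.mpr (div_pos hS hn')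
  · rintro _ ⟨θ, ⟨h0, hv⟩, rfl⟩
    exact likelihood_le hn hv hS (by simp [h0])

/-- The sample mean may be 0, which the alternative excludes, so the supremum need not be attained.
It is approached by letting nonzero means tend to the sample mean at fixed variance. -/
theorem isLUB_likelihood_alt {n : ℕ} (hn : n ≠ 0) {y : Fin n → ℝ} (hy : ∃ i j, y i ≠ y j) :
    IsLUB (likelihood y '' altHypothesis)
      (maxLikelihood n (∑ k, (y k - (1 / (n : ℝ)) * ∑ j, y j) ^ 2)) := by
  have hn' : (0 : ℝ) < n := Nat.cast_pos.mpr (Nat.pos_of_ne_zero hn)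
  set m := (1 / (n : ℝ)) * ∑ j, y j with hm
  have hS := sum_sub_sq_pos hy m
  refine ⟨?_, fun B hB => ?_⟩
  · rintro _ ⟨θ, ⟨-, hv⟩, rfl⟩
    refine likelihood_le hn hv hS ?_
    rw [sum_sub_sq hn y θ.1]
    exact le_add_of_nonneg_right (by positivity)
  · rw [← likelihood_mk_div hn hS]
    set v := ((∑ k, (y k - m) ^ 2) / n).toNNReal with hv
    have hvpos : 0 < v := Real.toNNReal_pos.mpr (div_pos hS hn')
    have hcont : Continuous fun μ => likelihood y (μ, v) := by
      simp only [likelihood_eq]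
      fun_prop
    have hne : (nhdsWithin m {(0 : ℝ)}ᶜ).NeBot :=
      mem_closure_iff_nhdsWithin_neBot.mp (dense_compl_singleton (0 : ℝ) m)
    refine le_of_tendsto (x := nhdsWithin m {(0 : ℝ)}ᶜ)
      ((hcont.tendsto m).mono_left nhdsWithin_le_nhds) ?_
    filter_upwards [self_mem_nhdsWithin] with μ hμ
    exact hB ⟨(μ, v), ⟨hμ, hvpos⟩, rfl⟩

theorem nonempty_nullHypothesis : nullHypothesis.Nonempty := ⟨(0, 1), rfl, one_pos⟩

theorem nonempty_altHypothesis : altHypothesis.Nonempty := ⟨(1, 1), one_ne_zero, one_pos⟩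

theorem supLikelihood_null {n : ℕ} (hn : n ≠ 0) {y : Fin n → ℝ} (hy : ∃ i j, y i ≠ y j) :
    supLikelihood nullHypothesis y = maxLikelihood n (∑ k, y k ^ 2) :=
  (isLUB_likelihood_null hn hy).csSup_eq (nonempty_nullHypothesis.image _)

theorem supLikelihood_alt {n : ℕ} (hn : n ≠ 0) {y : Fin n → ℝ} (hy : ∃ i j, y i ≠ y j) :
    supLikelihood altHypothesis y =
      maxLikelihood n (∑ k, (y k - (1 / (n : ℝ)) * ∑ j, y j) ^ 2) :=
  (isLUB_likelihood_alt hn hy).csSup_eq (nonempty_altHypothesis.image _)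

/-! ### The likelihood ratio as a function of the statistic -/

theorem maxLikelihood_div {n : ℕ} (hn : n ≠ 0) {S T : ℝ} (hS : 0 < S) (hT : 0 < T) :
    maxLikelihood n S / maxLikelihood n T = (T / S) ^ ((n : ℝ) / 2) := by
  have hn' : (0 : ℝ) < n := Nat.cast_pos.mpr (Nat.pos_of_ne_zero hn)
  have hpi := Real.pi_pos
  rw [maxLikelihood, maxLikelihood, mul_div_mul_right _ _ (Real.exp_ne_zero _), ← div_pow,
    inv_div_inv, ← Real.sqrt_div (by positivity), Real.sqrt_eq_rpow, ← Real.rpow_mul_natCast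
    (by positivity)]
  congr 1
  · field_simp
  · ring

theorem likelihoodRatio_eq {n : ℕ} (hn : n ≠ 0) {y : Fin n → ℝ} (hy : ∃ i j, y i ≠ y j) :
    likelihoodRatio y = ((∑ k, y k ^ 2) /
      ∑ k, (y k - (1 / (n : ℝ)) * ∑ j, y j) ^ 2) ^ ((n : ℝ) / 2) := by
  rw [likelihoodRatio, supLikelihood_null hn hy, supLikelihood_alt hn hy,
    maxLikelihood_div hn (sum_sub_sq_pos hy _) (by simpa using sum_sub_sq_pos hy 0)]

theorem one_add_statistic_div {n : ℕ} (hn : 2 ≤ n) {y : Fin n → ℝ} (hy : ∃ i j, y i ≠ y j) :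
    1 + statistic y / ((n : ℝ) - 1) =
      (∑ k, y k ^ 2) / ∑ k, (y k - (1 / (n : ℝ)) * ∑ j, y j) ^ 2 := by
  have hn0 : n ≠ 0 := by omega
  have hn1 : (0 : ℝ) < n - 1 := by
    have : (2 : ℝ) ≤ n := by exact_mod_cast hn
    linarith
  have hn' : (0 : ℝ) < n := by linarith
  have hS := sum_sub_sq_pos hy ((1 / (n : ℝ)) * ∑ j, y j)
  rw [statistic, sum_sq_eq hn0 y]
  generalize ∑ k, (y k - (1 / (n : ℝ)) * ∑ j, y j) ^ 2 = S at *
  field_simp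

theorem likelihoodRatio_eq_statistic {n : ℕ} (hn : 2 ≤ n) {y : Fin n → ℝ}
    (hy : ∃ i j, y i ≠ y j) :
    likelihoodRatio y = (1 + statistic y / ((n : ℝ) - 1)) ^ ((n : ℝ) / 2) := by
  rw [one_add_statistic_div hn hy, likelihoodRatio_eq (by omega) hy]

theorem statistic_nonneg {n : ℕ} (hn : n ≠ 0) (y : Fin n → ℝ) : 0 ≤ statistic y := by
  have hn1 : (0 : ℝ) ≤ n - 1 := by
    have : (1 : ℝ) ≤ n := by exact_mod_cast Nat.one_le_iff_ne_zero.mpr hn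
    linarith
  unfold statistic
  positivity

theorem statistic_eq_likelihoodRatio {n : ℕ} (hn : 2 ≤ n) {y : Fin n → ℝ}
    (hy : ∃ i j, y i ≠ y j) :
    statistic y = ((n : ℝ) - 1) * (likelihoodRatio y ^ (2 / (n : ℝ)) - 1) := by
  have h2 : (2 : ℝ) ≤ n := by exact_mod_cast hn
  have hn1 : (0 : ℝ) < n - 1 := by linarith
  have hst := statistic_nonneg (by omega) y
  rw [likelihoodRatio_eq_statistic hn hy, ← Real.rpow_mul (by positivity),
    show (n : ℝ) / 2 * (2 / n) = 1 by field_simp, Real.rpow_one]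
  field_simp
  ring

theorem lt_statistic_iff {n : ℕ} (hn : 2 ≤ n) {y : Fin n → ℝ} (hy : ∃ i j, y i ≠ y j) {b : ℝ}
    (hb : 0 ≤ b) :
    b < statistic y ↔ (1 + b / ((n : ℝ) - 1)) ^ ((n : ℝ) / 2) < likelihoodRatio y := by
  have h2 : (2 : ℝ) ≤ n := by exact_mod_cast hn
  have hn1 : (0 : ℝ) < n - 1 := by linarith
  have hst := statistic_nonneg (by omega) y
  rw [likelihoodRatio_eq_statistic hn hy,
    Real.rpow_lt_rpow_iff (by positivity) (by positivity) (by positivity), add_lt_add_iff_left,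
    div_lt_div_iff_of_pos_right hn1]

/-! ### Rotating the sample -/

theorem pi_gaussianReal_map_toLp {ι : Type*} [Fintype ι] (m : ι → ℝ) :
    (Measure.pi fun i => gaussianReal (m i) 1).map (WithLp.toLp 2) =
      (stdGaussian (EuclideanSpace ℝ ι)).map (WithLp.toLp 2 m + ·) := by
  have h : (Measure.pi fun i => gaussianReal (m i) 1) =
      (Measure.pi fun _ : ι => gaussianReal 0 1).map (fun x i => m i + x i) := by
    rw [Measure.pi_map_pi (f := fun i x => m i + x) fun i => by fun_prop]
    simp [gaussianReal_map_const_add]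
  rw [h, ← map_pi_eq_stdGaussian, Measure.map_map (by fun_prop) (by fun_prop),
    Measure.map_map (by fun_prop) (by fun_prop)]
  rfl

/-- Rotation of a Gaussian vector with identity covariance rotates its mean. -/
theorem pi_gaussianReal_map_isometry {ι : Type*} [Fintype ι]
    (U : EuclideanSpace ℝ ι ≃ₗᵢ[ℝ] EuclideanSpace ℝ ι) (m : ι → ℝ) :
    (Measure.pi fun i => gaussianReal (m i) 1).map (fun x => (U (WithLp.toLp 2 x)).ofLp) =
      Measure.pi fun i => gaussianReal (U (WithLp.toLp 2 m) i) 1 := by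
  have hU : Measurable U := U.continuous.measurable
  have hof : Measurable (WithLp.ofLp : EuclideanSpace ℝ ι → ι → ℝ) := by fun_prop
  have hto : Measurable (WithLp.toLp 2 : (ι → ℝ) → EuclideanSpace ℝ ι) := by fun_prop
  have hrot : (stdGaussian (EuclideanSpace ℝ ι)).map (fun x => U (WithLp.toLp 2 m + x)) =
      (stdGaussian (EuclideanSpace ℝ ι)).map (U (WithLp.toLp 2 m) + ·) := by
    conv_rhs => rw [← stdGaussian_map U, Measure.map_map (by fun_prop) hU]
    congr 1
    ext1 x
    simp
  have h := pi_gaussianReal_map_toLp fun i => U (WithLp.toLp 2 m) i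
  calc _ = (((Measure.pi fun i => gaussianReal (m i) 1).map (WithLp.toLp 2)).map U).map
        WithLp.ofLp := by
        rw [Measure.map_map hU hto, Measure.map_map hof (hU.comp hto)]
        rfl
    _ = ((Measure.pi fun i => gaussianReal (U (WithLp.toLp 2 m) i) 1).map
        (WithLp.toLp 2)).map WithLp.ofLp := by
        rw [pi_gaussianReal_map_toLp, Measure.map_map hU (by fun_prop), h]
        exact congrArg _ hrot
    _ = _ := by
        rw [Measure.map_map hof hto]
        exact Measure.map_id

theorem measurable_statistic {n : ℕ} : Measurable (statistic (n := n)) := by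
  unfold statistic
  fun_prop

theorem statistic_div {n : ℕ} (y : Fin n → ℝ) {c : ℝ} (hc : c ≠ 0) :
    statistic (fun k => y k / c) = statistic y := by
  have h : ∀ k, (y k / c - (1 / (n : ℝ)) * ∑ j, y j / c) ^ 2 =
      (y k - (1 / (n : ℝ)) * ∑ j, y j) ^ 2 / c ^ 2 := by
    intro k
    rw [← Finset.sum_div, ← div_pow]
    congr 1
    ring
  simp only [statistic, h]
  rw [← Finset.sum_div, ← Finset.sum_div, div_pow, mul_div_assoc', mul_div_assoc',
    div_div_div_cancel_right₀ (pow_ne_zero 2 hc)]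

/-- The ratio of mean squares of the first coordinate and of the remaining ones. -/
noncomputable def meanSquareRatio {m : ℕ} (z : Fin (m + 1) → ℝ) : ℝ :=
  (z 0 ^ 2 / ((1 : ℕ) : ℝ)) / ((∑ i : Fin m, z i.succ ^ 2) / (m : ℝ))

theorem measurable_meanSquareRatio {m : ℕ} : Measurable (meanSquareRatio (m := m)) := by
  unfold meanSquareRatio
  fun_prop

/-- A rotation taking the diagonal direction to the first coordinate axis turns the statistic
into the mean square ratio. -/
theorem exists_isometry_statistic (m : ℕ) (c : ℝ) :
    ∃ U : EuclideanSpace ℝ (Fin (m + 1)) ≃ₗᵢ[ℝ] EuclideanSpace ℝ (Fin (m + 1)),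
      (∀ i, U (WithLp.toLp 2 fun _ => c) i =
        if (i : ℕ) = 0 then √((m + 1 : ℕ) : ℝ) * |c| else 0) ∧
      ∀ x : Fin (m + 1) → ℝ, statistic x = meanSquareRatio (U (WithLp.toLp 2 x)).ofLp := by
  -- The sign `ε` orients the diagonal so that the rotated mean is nonnegative, as `√lam` is in
  -- `noncentralChiSq`.
  obtain ⟨ε, hε, hεc⟩ : ∃ ε : ℝ, ε ^ 2 = 1 ∧ c = |c| * ε := by
    rcases le_total 0 c with h | h
    · exact ⟨1, by norm_num, by rw [abs_of_nonneg h, mul_one]⟩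
    · exact ⟨-1, by norm_num, by rw [abs_of_nonpos h]; ring⟩
  set N : ℝ := ((m + 1 : ℕ) : ℝ) with hN
  have hNpos : 0 < N := by positivity
  have hsq : √N ^ 2 = N := Real.sq_sqrt hNpos.le
  have hs0 : √N ≠ 0 := (Real.sqrt_pos.mpr hNpos).ne'
  let v : EuclideanSpace ℝ (Fin (m + 1)) := WithLp.toLp 2 fun _ => ε / √N
  let e : EuclideanSpace ℝ (Fin (m + 1)) := EuclideanSpace.single 0 1
  have hv : ‖v‖ = 1 := by
    rw [← sq_eq_sq₀ (norm_nonneg _) zero_le_one, EuclideanSpace.real_norm_sq_eq]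
    simp only [v, Finset.sum_const, Finset.card_univ, Fintype.card_fin, nsmul_eq_mul, div_pow, hε,
      hsq, ← hN]
    field_simp
  have he : ‖e‖ = 1 := by simp [e]
  -- The reflection in the hyperplane orthogonal to `v - e` exchanges the unit vectors `v` and `e`.
  let U := (ℝ ∙ (v - e))ᗮ.reflection
  have hUv : U v = e := Submodule.reflection_sub (hv.trans he.symm)
  refine ⟨U, fun i => ?_, fun x => ?_⟩
  · have hc : (WithLp.toLp 2 fun _ => c : EuclideanSpace ℝ (Fin (m + 1))) = (√N * |c|) • v := by
      ext i
      simp only [v, PiLp.smul_apply, smul_eq_mul]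
      conv_lhs => rw [hεc]
      field_simp
    rw [hc, map_smul, hUv]
    simp [e, PiLp.single_apply]
  · set X : EuclideanSpace ℝ (Fin (m + 1)) := WithLp.toLp 2 x with hX
    have h0 : U X 0 = ε / √N * ∑ k, x k := by
      have h := U.inner_map_map v X
      rw [hUv] at h
      simpa [e, v, X, PiLp.inner_apply, Finset.mul_sum, Finset.sum_mul, mul_comm] using h
    have h0' : U X 0 ^ 2 = (∑ k, x k) ^ 2 / N := by
      rw [h0, mul_pow, div_pow, hε, hsq]
      ring
    have hnorm : ∑ k, U X k ^ 2 = ∑ k, x k ^ 2 := by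
      have h := congrArg (· ^ 2) (U.norm_map X)
      simpa only [EuclideanSpace.real_norm_sq_eq] using h
    rw [Fin.sum_univ_succ, h0', sum_sq_eq (Nat.succ_ne_zero m) x] at hnorm
    have hres : ∑ i : Fin m, U X i.succ ^ 2 =
        ∑ k, (x k - (1 / ((m + 1 : ℕ) : ℝ)) * ∑ j, x j) ^ 2 := by
      rw [← hN] at hnorm ⊢
      linarith
    rw [meanSquareRatio, hres, h0', statistic, ← hN]
    have hm : N - 1 = m := by rw [hN]; push_cast; ring
    rw [hm, Nat.cast_one, div_one]
    -- `S` and `m` may vanish: both sides are then 0, since division by zero gives 0.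
    generalize ∑ k, (x k - 1 / N * ∑ j, x j) ^ 2 = S
    rw [div_div_eq_mul_div, div_mul_eq_mul_div, div_div, mul_comm (m : ℝ)]

/-! ### Fisher laws and the law of the statistic -/

theorem noncentralChiSq_one (lam : ℝ) :
    noncentralChiSq 1 lam = (gaussianReal (√lam) 1).map (· ^ 2) := by
  have h := (measurePreserving_piUnique fun i : Fin 1 =>
    gaussianReal (if (i : ℕ) = 0 then √lam else 0) 1).map_eq
  simp only [Fin.default_eq_zero, Fin.val_zero, if_true] at h
  rw [noncentralChiSq, ← h, Measure.map_map (by fun_prop) (MeasurableEquiv.measurable _)]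
  congr 1
  ext x
  simp

/-- Splitting off coordinate 0, the only one with a possibly nonzero mean, yields the independent
numerator and denominator. -/
theorem noncentralFisher_one_eq (m : ℕ) (lam : ℝ) :
    noncentralFisher 1 m lam =
      (Measure.pi fun i : Fin (m + 1) =>
        gaussianReal (if (i : ℕ) = 0 then √lam else 0) 1).map meanSquareRatio := by
  have h := (measurePreserving_piFinSuccAbove (fun i : Fin (m + 1) =>
    gaussianReal (if (i : ℕ) = 0 then √lam else 0) 1) 0).map_eq
  simp only [Fin.val_zero, if_true, Fin.zero_succAbove, Fin.val_succ, Nat.succ_ne_zero,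
    if_false] at h
  rw [noncentralFisher, noncentralChiSq_one, chiSq,
    Measure.map_prod_map _ _ (by fun_prop) (by fun_prop), ← h,
    Measure.map_map (by fun_prop) (by fun_prop),
    Measure.map_map (by fun_prop) (MeasurableEquiv.measurable _)]
  congr 1

theorem fisher_eq_noncentralFisher (d₁ d₂ : ℕ) : fisher d₁ d₂ = noncentralFisher d₁ d₂ 0 := by
  simp [fisher, noncentralFisher, chiSq, noncentralChiSq]

theorem pi_gaussianReal_map_div (n : ℕ) (a : ℝ) {σ : ℝ≥0} (hσ : 0 < σ) :
    (Measure.pi fun _ : Fin n => gaussianReal a (σ ^ 2)).map (fun y k => y k / (σ : ℝ)) =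
      Measure.pi fun _ : Fin n => gaussianReal (a / σ) 1 := by
  rw [Measure.pi_map_pi (f := fun _ x => x / (σ : ℝ)) fun i => by fun_prop]
  have hlaw : (gaussianReal a (σ ^ 2)).map (· / (σ : ℝ)) = gaussianReal (a / σ) 1 := by
    rw [gaussianReal_map_div_const]
    congr 1
    ext
    have : (σ : ℝ) ≠ 0 := NNReal.coe_ne_zero.mpr hσ.ne'
    simp [this]
  simp only [hlaw]

theorem map_statistic (m : ℕ) (a : ℝ) {σ : ℝ≥0} (hσ : 0 < σ) :
    (Measure.pi fun _ : Fin (m + 1) => gaussianReal a (σ ^ 2)).map statistic =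
      noncentralFisher 1 m (((m + 1 : ℕ) : ℝ) * a ^ 2 / (σ : ℝ) ^ 2) := by
  have hσ' : (0 : ℝ) < σ := hσ
  obtain ⟨U, hUc, hU⟩ := exists_isometry_statistic m (a / σ)
  have hmeas : Measurable fun x : Fin (m + 1) → ℝ => (U (WithLp.toLp 2 x)).ofLp := by
    have := U.continuous.measurable
    fun_prop
  have hsqrt : √(((m + 1 : ℕ) : ℝ) * a ^ 2 / (σ : ℝ) ^ 2) =
      √((m + 1 : ℕ) : ℝ) * |a / σ| := by
    rw [mul_div_assoc, ← div_pow, Real.sqrt_mul (Nat.cast_nonneg _), Real.sqrt_sq_eq_abs]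
  have hrot := pi_gaussianReal_map_isometry U fun _ => a / σ
  simp only [hUc] at hrot
  rw [noncentralFisher_one_eq, hsqrt, ← hrot, ← pi_gaussianReal_map_div (m + 1) a hσ,
    Measure.map_map measurable_meanSquareRatio hmeas,
    Measure.map_map (measurable_meanSquareRatio.comp hmeas) (by fun_prop)]
  congr 1
  ext y
  rw [← statistic_div y hσ'.ne', hU]
  rfl

theorem hasLaw_statistic {Ω : Type*} [MeasurableSpace Ω] {P : Measure Ω} {n : ℕ} (hn : n ≠ 0)
    {a : ℝ} {σ : ℝ≥0} (hσ : 0 < σ) {Y : Fin n → Ω → ℝ}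
    (hlaw : ∀ k, HasLaw (Y k) (gaussianReal a (σ ^ 2)) P) (hindep : iIndepFun Y P) :
    HasLaw (fun ω => statistic fun k => Y k ω)
      (noncentralFisher 1 (n - 1) ((n : ℝ) * a ^ 2 / (σ : ℝ) ^ 2)) P := by
  obtain ⟨m, rfl⟩ := Nat.exists_eq_succ_of_ne_zero hn
  exact HasLaw.comp ⟨measurable_statistic.aemeasurable, map_statistic m a hσ⟩
    (hindep.hasLaw_pi hlaw)

/-- By Fubini the diagonal is null for the product law, its sections being singletons. -/
theorem IndepFun.ae_ne {Ω : Type*} [MeasurableSpace Ω] {P : Measure Ω} [IsFiniteMeasure P]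
    {X Y : Ω → ℝ} {μ ν : Measure ℝ} [SFinite ν] [NullSingletonClass ν] (hX : HasLaw X μ P)
    (hY : HasLaw Y ν P) (h : X ⟂ᵢ[P] Y) : ∀ᵐ ω ∂P, X ω ≠ Y ω := by
  have hpair := (indepFun_iff_hasLaw_prodMk_prod hX hY).mp h
  have hdiag : MeasurableSet {p : ℝ × ℝ | p.1 = p.2} :=
    measurableSet_eq_fun measurable_fst measurable_snd
  rw [ae_iff]
  simp only [ne_eq, not_not]
  rw [hpair.measure_eq hdiag, Measure.measure_prod_null hdiag]
  filter_upwards with x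
  exact measure_mono_null (t := {x}) (fun y hy => (Eq.symm hy : y = x)) (measure_singleton x)

end GLRT

theorem mainTheorem3 {Ω : Type*} [MeasurableSpace Ω] (P : Measure Ω) [IsProbabilityMeasure P]
    (n : ℕ) (hn : 2 ≤ n) (a : ℝ) (σ : ℝ≥0) (hσ : 0 < σ) (Y : Fin n → Ω → ℝ)
    (hlaw : ∀ k, HasLaw (Y k) (gaussianReal a (σ ^ 2)) P) (hindep : iIndepFun Y P) :
    (∀ y : Fin n → ℝ, (∃ i j, y i ≠ y j) →
      BddAbove (GLRT.likelihood y '' GLRT.nullHypothesis) ∧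
      BddAbove (GLRT.likelihood y '' GLRT.altHypothesis) ∧
      0 < GLRT.supLikelihood GLRT.nullHypothesis y ∧
      GLRT.statistic y =
        ((n : ℝ) - 1) * (GLRT.likelihoodRatio y ^ (2 / (n : ℝ)) - 1) ∧
      ∀ b : ℝ, 0 ≤ b →
        (b < GLRT.statistic y ↔
          (1 + b / ((n : ℝ) - 1)) ^ ((n : ℝ) / 2) < GLRT.likelihoodRatio y)) ∧
    (∀ᵐ ω ∂P, ∃ i j, Y i ω ≠ Y j ω) ∧
    (a = 0 → HasLaw (fun ω => GLRT.statistic fun k => Y k ω) (GLRT.fisher 1 (n - 1)) P) ∧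
    (a ≠ 0 → HasLaw (fun ω => GLRT.statistic fun k => Y k ω)
      (GLRT.noncentralFisher 1 (n - 1) ((n : ℝ) * a ^ 2 / (σ : ℝ) ^ 2)) P) := by
  have hn0 : n ≠ 0 := by omega
  refine ⟨fun y hy => ⟨⟨_, (GLRT.isLUB_likelihood_null hn0 hy).1⟩,
    ⟨_, (GLRT.isLUB_likelihood_alt hn0 hy).1⟩, ?_, GLRT.statistic_eq_likelihoodRatio hn hy,
    fun b hb => GLRT.lt_statistic_iff hn hy hb⟩, ?_, ?_, fun _ =>
    GLRT.hasLaw_statistic hn0 hσ hlaw hindep⟩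
  · rw [GLRT.supLikelihood_null hn0 hy]
    exact GLRT.maxLikelihood_pos hn0 (by simpa using GLRT.sum_sub_sq_pos hy 0)
  · let i : Fin n := ⟨0, by omega⟩
    let j : Fin n := ⟨1, by omega⟩
    have hij : i ≠ j := by simp [i, j]
    have := nullSingletonClass_gaussianReal (μ := a) (pow_ne_zero 2 hσ.ne')
    filter_upwards [GLRT.IndepFun.ae_ne (hlaw i) (hlaw j) (hindep.indepFun hij)] with ω hω
    exact ⟨i, j, hω⟩
  · rintro rfl
    have h := GLRT.hasLaw_statistic hn0 hσ hlaw hindep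
    rw [GLRT.fisher_eq_noncentralFisher]
    simpa using h
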